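/- Let $\alpha,\beta>0$ and let $d\ge 1$ be an integer. A pdf is an a.e. non-negative function with Lebesgue integral one, and equalities of functions are meant a.e. Let $\mathcal D_d$ be the set of all pdfs on $\mathbb R^d$ supported on $[0,1]^d$. A pdf $p$ on $\mathbb R^d$ has a non-negative Lipschitz (NL-) spectrum $(w,L)$, where $w=(w_i)_{i\ge1}$ and $L=(L_i)_{i\ge1}$ are non-negative sequences with $w_1>0$ and $\sum_{i\ge 1} w_i=1$, if $p(x)=\sum_{i=1}^\infty w_i\prod_{j=1}^d p_{i,j}(x_j)$ for some pdfs $p_{i,j}$ on $\mathbb R$ such that $p_{i,j}$ is $L_i$-Lipschitz for all $i,j$. For a non-negative, non-increasing sequence $W=(W_k)_{k\ge1}$ that converges to $0$ and a non-negative, non-decreasing sequence $\tilde L=(\tilde L_k)_{k\ge1}$, the NL-class $\mathfrak V(W,\tilde L)$ is the set of all pdfs on $\mathbb R^d$ that have an NL-spectrum $(w,L)$ with $L_k\le\tilde L_k$ and $\sum_{i=k+1}^\infty w_i\le W_k$ for all $k\ge1$. There is a sequence of estimators $(V_n)_{n\ge 1}$, depending only on $\alpha,\beta,d$, where $V_n$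 is a measurable function of $n$ i.i.d. observations $X_1,\dots,X_n\sim p$ with values in $\mathcal D_d$, such that: (i) (universal consistency) for every $p\in\mathcal D_d$, $\|V_n-p\|_1\to 0$ in probability as $n\to\infty$ when sampling from $p$; (ii) for all $W,\tilde L$ as above with $W_k\in O(k^{-\alpha})$ and $\tilde L_k\in O(k^{\beta})$, and every $p\in\mathcal D_d\cap\mathfrak V(W,\tilde L)$, $\|V_n-p\|_1\in\tilde O\big(n^{-\alpha/(3\alpha+\beta+1)}\big)$ in probability when sampling from $p$, i.e. there are constants $C,c\ge0$ (which may depend on $p$) with $P\big(\|V_n-p\|_1> C\,n^{-\alpha/(3\alpha+\beta+1)}(\log n)^c\big)\to0$ as $n\to\infty$. -/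

import Mathlib

open MeasureTheory Filter Topology Asymptotics
open scoped NNReal ENNReal

noncomputable section

namespace NLSpectrum

/-- A probability density function on a measure space: an integrable, almost everywhere
nonnegative real function with integral one. -/
def IsPdf {E : Type*} [MeasureSpace E] (p : E → ℝ) : Prop :=
  Integrable p ∧ (∀ᵐ x, 0 ≤ p x) ∧ ∫ x, p x = 1

/-- The densities on `ℝ^d` supported on the unit cube `[0,1]^d`. -/
def unitCubeDensities (d : ℕ) : Set ((Fin d → ℝ) → ℝ) :=
  {p | IsPdf p ∧ ∀ᵐ x, x ∉ Set.Icc (0 : Fin d → ℝ) 1 → p x = 0}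

/-- `p` has non-negative Lipschitz spectrum `(w, L)`. Sequences that are indexed by `1, 2, …` in
the mathematical text are indexed here by `0, 1, …`, so `w i` and `L i` are the weight and the
Lipschitz constant of component number `i + 1`. -/
def HasNLSpectrum {d : ℕ} (p : (Fin d → ℝ) → ℝ) (w : ℕ → ℝ) (L : ℕ → ℝ≥0) : Prop :=
  (∀ i, 0 ≤ w i) ∧ 0 < w 0 ∧ HasSum w 1 ∧
    ∃ q : ℕ → Fin d → ℝ → ℝ,
      (∀ i j, IsPdf (q i j) ∧ LipschitzWith (L i) (q i j)) ∧
      ∀ᵐ x, HasSum (fun i => w i * ∏ j, q i j (x j)) (p x)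

/-- The non-negative Lipschitz class with parameters `W` and `Lt`: all densities on `ℝ^d` having a
non-negative Lipschitz spectrum `(w, L)` with `L ≤ Lt` termwise and with the tails of `w` bounded
by `W`. With indices shifted by one, `W k` bounds the sum of the weights after the first
`k + 1` ones. -/
def NLClass (d : ℕ) (W Lt : ℕ → ℝ) : Set ((Fin d → ℝ) → ℝ) :=
  {p | IsPdf p ∧ ∃ (w : ℕ → ℝ) (L : ℕ → ℝ≥0), HasNLSpectrum p w L ∧
    (∀ k, (L k : ℝ) ≤ Lt k) ∧ ∀ k, ∑' i, w (k + 1 + i) ≤ W k}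

/-- Admissible parameters of a non-negative Lipschitz class. -/
def IsNLParam (W Lt : ℕ → ℝ) : Prop :=
  (∀ k, 0 ≤ W k) ∧ Antitone W ∧ Tendsto W atTop (𝓝 0) ∧ (∀ k, 0 ≤ Lt k) ∧ Monotone Lt

/-- An estimator based on `n` observations in `ℝ^d`, with values in the densities on the unit cube:
`V x` is the estimated density for the sample `x`, and `V x y` is jointly measurable in the
sample `x` and the point `y`. -/
def IsEstimator {d n : ℕ} (V : (Fin n → Fin d → ℝ) → (Fin d → ℝ) → ℝ) : Prop :=
  Measurable (fun z : (Fin n → Fin d → ℝ) × (Fin d → ℝ) => V z.1 z.2) ∧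
    ∀ x, V x ∈ unitCubeDensities d

/-- The joint law of `n` independent observations with density `p`. -/
def sampleLaw {d : ℕ} (p : (Fin d → ℝ) → ℝ) (n : ℕ) : Measure (Fin n → Fin d → ℝ) :=
  Measure.pi fun _ => (volume : Measure (Fin d → ℝ)).withDensity fun x => ENNReal.ofReal (p x)

/-- The `L¹` distance of two functions on `ℝ^d`. -/
def l1Dist {d : ℕ} (f g : (Fin d → ℝ) → ℝ) : ℝ := ∫ y, |f y - g y|

/-- The probability that the `L¹` error of the `n`-th estimator exceeds `t`, for `n` independent
observations with density `p`. -/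
def errorProb {d : ℕ} (V : (n : ℕ) → (Fin n → Fin d → ℝ) → (Fin d → ℝ) → ℝ)
    (p : (Fin d → ℝ) → ℝ) (n : ℕ) (t : ℝ) : ℝ≥0∞ :=
  sampleLaw p n {x | t < l1Dist (V n x) p}

/-- Under sampling from `p`, the `L¹` error of the estimators tends to zero in probability. -/
def ConsistentAt {d : ℕ} (V : (n : ℕ) → (Fin n → Fin d → ℝ) → (Fin d → ℝ) → ℝ)
    (p : (Fin d → ℝ) → ℝ) : Prop :=
  ∀ ε : ℝ, 0 < ε → Tendsto (fun n => errorProb V p n ε) atTop (𝓝 0)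

/-- Under sampling from `p`, the `L¹` error of the estimators is, in probability, at most of order
`r n` up to a power of `log n`: for some `C` and `c`, it is at most `C * r n * (log n) ^ c` with
probability tending to one. Up to the choice of `c` this is the same as boundedness in
probability of the error divided by `r n * (log n) ^ c`. -/
def SoftORateAt {d : ℕ} (V : (n : ℕ) → (Fin n → Fin d → ℝ) → (Fin d → ℝ) → ℝ)
    (p : (Fin d → ℝ) → ℝ) (r : ℕ → ℝ) : Prop :=
  ∃ (C : ℝ) (c : ℕ),
    Tendsto (fun n => errorProb V p n (C * (r n * Real.log n ^ c))) atTop (𝓝 0)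

end NLSpectrum

end

namespace NLSpectrum

/-! The estimator picks, from a finite family of densities that grows with `n`, the member whose
masses best match the empirical frequencies on the sets `{f s' < f s}` (minimum distance selection,
`exists_minimumDistance_estimator`). With `N` members its error is at most five times the best
approximation error in the family plus a stochastic term of order `√(log (N n) / n)`, with
probability tending to one.

The family has two parts. One is a cover of mixtures of `K ≈ n ^ γ` products of Lipschitz densities
on `[0,1]`, discretized at resolution `b ≈ K ^ (α + β)` (`exists_cover_nearMixture`). Members of the
class are close to such mixtures by truncation (`isNearMixture_of_mem_NLClass`). The other part is
an initial segment of a dense sequence (`exists_dense_seq`), which yields consistency and barely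
enlarges the family.

Up to logarithms, truncation costs `K ^ (-α)`, discretization costs `K ^ β / b ≈ K ^ (-α)`
(`coverError_le`), and `log N` is of order `K * b ≈ n ^ (γ * (1 + α + β))` (`selectionError_le`).
Equating `n ^ (-γ * α)` with the square root of `K * b / n` gives `γ = 1 / (3 * α + β + 1)`. The
constants hidden in the bounds on `W` and `L` are unknown to the estimator; a factor `log n`
eventually exceeds them (`eventually_le_log_mul`). -/

theorem l1Dist_comm {d : ℕ} (f g : (Fin d → ℝ) → ℝ) : l1Dist f g = l1Dist g f := by
  simp only [l1Dist, abs_sub_comm]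

theorem l1Dist_triangle {d : ℕ} {f g h : (Fin d → ℝ) → ℝ} (hf : Integrable f)
    (hg : Integrable g) (hh : Integrable h) : l1Dist f h ≤ l1Dist f g + l1Dist g h := by
  refine le_of_le_of_eq (integral_mono (hf.sub hh).abs ((hf.sub hg).abs.add (hg.sub hh).abs)
    fun x => abs_sub_le _ (g x) _) ?_
  exact integral_add (hf.sub hg).abs (hg.sub hh).abs

/-! ### Concentration of empirical frequencies. -/

/-- The observation law with density `p`. -/
noncomputable def obsLaw {d : ℕ} (p : (Fin d → ℝ) → ℝ) : Measure (Fin d → ℝ) :=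
  (volume : Measure (Fin d → ℝ)).withDensity fun x => ENNReal.ofReal (p x)

theorem obsLaw_real {d : ℕ} {p : (Fin d → ℝ) → ℝ} (hp : IsPdf p) {A : Set (Fin d → ℝ)}
    (hA : MeasurableSet A) : (obsLaw p).real A = ∫ x in A, p x := by
  rw [Measure.real, obsLaw, withDensity_apply _ hA,
    ← ofReal_integral_eq_lintegral_ofReal hp.1.integrableOn (ae_restrict_of_ae hp.2.1),
    ENNReal.toReal_ofReal (integral_nonneg_of_ae (ae_restrict_of_ae hp.2.1))]

theorem isProbabilityMeasure_obsLaw {d : ℕ} {p : (Fin d → ℝ) → ℝ} (hp : IsPdf p) :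
    IsProbabilityMeasure (obsLaw p) := by
  constructor
  rw [obsLaw, withDensity_apply _ MeasurableSet.univ, Measure.restrict_univ,
    ← ofReal_integral_eq_lintegral_ofReal hp.1 hp.2.1, hp.2.2, ENNReal.ofReal_one]

/-- The empirical frequency of the set `A` in the sample `x`. -/
noncomputable def freq {E : Type*} {n : ℕ} (A : Set E) (x : Fin n → E) : ℝ :=
  (∑ i, A.indicator (fun _ => (1 : ℝ)) (x i)) / n

/-- A variable with values in an interval of length one is sub-Gaussian with parameter `1 / 4`. The
interval is left general so that an indicator and its negative are both covered. -/
theorem hoeffding_one_sided {E : Type*} [MeasurableSpace E] (μ : Measure E)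
    [IsProbabilityMeasure μ] {f : E → ℝ} (hf : Measurable f) {a b : ℝ} (hab : b - a = 1)
    (hfI : ∀ x, f x ∈ Set.Icc a b) {n : ℕ} (hn : 0 < n) {t : ℝ} (ht : 0 ≤ t) :
    (Measure.pi fun _ : Fin n => μ).real {x | n * t ≤ ∑ i, (f (x i) - ∫ y, f y ∂μ)}
      ≤ Real.exp (-2 * n * t ^ 2) := by
  have hsub : ∀ i ∈ (Finset.univ : Finset (Fin n)),
      ProbabilityTheory.HasSubgaussianMGF
        (fun x : Fin n → E => f (x i) - ∫ y, f y ∂μ) (1 / 4)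
        (Measure.pi fun _ : Fin n => μ) := by
    intro i _
    have h := ProbabilityTheory.hasSubgaussianMGF_of_mem_Icc
      (μ := Measure.pi fun _ : Fin n => μ) (X := fun x => f (x i)) (a := a) (b := b)
      (hf.comp (measurable_pi_apply i)).aemeasurable (ae_of_all _ fun x => hfI _)
    have hint : ∫ x, f (x i) ∂(Measure.pi fun _ : Fin n => μ) = ∫ y, f y ∂μ :=
      integral_comp_eval (μ := fun _ : Fin n => μ) (i := i) hf.aestronglyMeasurable
    rw [hint] at h
    convert h using 1
    rw [hab]
    ext
    norm_num
  have hind : ProbabilityTheory.iIndepFun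
      (fun (i : Fin n) (x : Fin n → E) => f (x i) - ∫ y, f y ∂μ)
      (Measure.pi fun _ : Fin n => μ) :=
    ProbabilityTheory.iIndepFun_pi (X := fun _ y => f y - ∫ z, f z ∂μ)
      fun _ => (hf.sub_const _).aemeasurable
  have hmain := ProbabilityTheory.HasSubgaussianMGF.measure_sum_ge_le_of_iIndepFun hind hsub
    (ε := n * t) (by positivity)
  refine hmain.trans (Real.exp_le_exp.2 (le_of_eq ?_))
  have : (n : ℝ) ≠ 0 := by positivity
  simp
  field_simp
  ring

theorem freq_deviation {d n : ℕ} (hn : 0 < n) {p : (Fin d → ℝ) → ℝ} (hp : IsPdf p)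
    {A : Set (Fin d → ℝ)} (hA : MeasurableSet A) {t : ℝ} (ht : 0 ≤ t) :
    sampleLaw p n {x | t < |freq A x - ∫ y in A, p y|}
      ≤ ENNReal.ofReal (2 * Real.exp (-2 * n * t ^ 2)) := by
  have := isProbabilityMeasure_obsLaw hp
  have hn' : (0 : ℝ) < n := by exact_mod_cast hn
  set f : (Fin d → ℝ) → ℝ := A.indicator fun _ => 1 with hfdef
  have hf : Measurable f := measurable_const.indicator hA
  have hfint : ∫ y, f y ∂(obsLaw p) = ∫ y in A, p y := by
    rw [hfdef, integral_indicator hA, setIntegral_const, obsLaw_real hp hA]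
    simp
  have hf01 : ∀ x, f x ∈ Set.Icc (0 : ℝ) 1 := by
    intro x
    by_cases h : x ∈ A <;> simp [hfdef, h]
  have h1 := hoeffding_one_sided (obsLaw p) hf (by norm_num) hf01 hn ht
  have h2 := hoeffding_one_sided (obsLaw p) (f := fun x => - f x) hf.neg (a := -1) (b := 0)
    (by norm_num) (fun x => by have := hf01 x; simpa [and_comm] using this) hn ht
  rw [hfint] at h1
  rw [integral_neg, hfint] at h2
  change (sampleLaw p n).real _ ≤ _ at h1
  change (sampleLaw p n).real _ ≤ _ at h2
  have : IsProbabilityMeasure (sampleLaw p n) :=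
    inferInstanceAs (IsProbabilityMeasure (Measure.pi fun _ : Fin n => obsLaw p))
  have hsub : {x : Fin n → Fin d → ℝ | t < |freq A x - ∫ y in A, p y|} ⊆
      {x | n * t ≤ ∑ i, (f (x i) - ∫ y in A, p y)} ∪
      {x | n * t ≤ ∑ i, (- f (x i) - - ∫ y in A, p y)} := by
    intro x hx
    have hfreq : (n : ℝ) * freq A x = ∑ i, f (x i) := by
      rw [freq]; field_simp
      rfl
    simp only [Set.mem_ofPred_eq, Set.mem_union, Finset.sum_sub_distrib, Finset.sum_neg_distrib,
      Finset.sum_const, Finset.card_univ, Fintype.card_fin, nsmul_eq_mul] at hx ⊢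
    rw [← hfreq]
    rcases lt_abs.1 hx with h | h
    · left; nlinarith
    · right; nlinarith
  refine (measure_mono hsub).trans ?_
  rw [ENNReal.le_ofReal_iff_toReal_le (measure_ne_top _ _) (by positivity)]
  calc _ ≤ _ := measureReal_union_le _ _
    _ ≤ _ := by linarith

/-! ### Minimum distance selection from a finite family. -/

theorem abs_setIntegral_sub_le {d : ℕ} {f g : (Fin d → ℝ) → ℝ} (hf : Integrable f)
    (hg : Integrable g) (A : Set (Fin d → ℝ)) :
    |(∫ y in A, f y) - ∫ y in A, g y| ≤ l1Dist f g := by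
  rw [← integral_sub hf.integrableOn hg.integrableOn]
  refine (abs_integral_le_integral_abs).trans ?_
  exact setIntegral_le_integral (hf.sub hg).abs (ae_of_all _ fun _ => abs_nonneg _)

/-- Scheffé's identity. -/
theorem l1Dist_eq_two_mul_setIntegral {d : ℕ} {f g : (Fin d → ℝ) → ℝ} (hf : IsPdf f)
    (hg : IsPdf g) (hfm : Measurable f) (hgm : Measurable g) :
    l1Dist f g = 2 * ((∫ y in {y | g y < f y}, f y) - ∫ y in {y | g y < f y}, g y) := by
  have hA : MeasurableSet {y | g y < f y} := measurableSet_lt hgm hfm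
  have hint : Integrable fun y => f y - g y := hf.1.sub hg.1
  have h0 : ∫ y, (f y - g y) = 0 := by rw [integral_sub hf.1 hg.1, hf.2.2, hg.2.2, sub_self]
  rw [← integral_sub hf.1.integrableOn hg.1.integrableOn, ← integral_indicator hA,
    ← add_zero (l1Dist f g), ← h0, l1Dist, ← integral_add hint.abs hint, ← integral_const_mul]
  congr 1
  ext y
  by_cases hy : g y < f y
  · rw [Set.indicator_of_mem (by exact hy), abs_of_pos (sub_pos.2 hy)]; ring
  · rw [Set.indicator_of_notMem (by exact hy), abs_of_nonpos (by linarith)]; ring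

/-- The minimum distance (Yatracos) estimator for a finite family of densities. -/
theorem exists_minimumDistance_estimator {d n : ℕ} (hn : 0 < n) {ι : Type*} [Fintype ι]
    [Nonempty ι] {f : ι → (Fin d → ℝ) → ℝ} (hf : ∀ s, f s ∈ unitCubeDensities d)
    (hfm : ∀ s, Measurable (f s)) :
    ∃ V : (Fin n → Fin d → ℝ) → (Fin d → ℝ) → ℝ, IsEstimator V ∧
      ∀ p : (Fin d → ℝ) → ℝ, IsPdf p → ∀ (s : ι) (t : ℝ), 0 ≤ t →
        sampleLaw p n {x | 5 * l1Dist (f s) p + 4 * t < l1Dist (V x) p}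
          ≤ ENNReal.ofReal (2 * (Fintype.card ι : ℝ) ^ 2 * Real.exp (-2 * n * t ^ 2)) := by
  classical
  set A : ι × ι → Set (Fin d → ℝ) := fun u => {y | f u.2 y < f u.1 y} with hAdef
  have hA : ∀ u, MeasurableSet (A u) := fun u => measurableSet_lt (hfm _) (hfm _)
  set Δ : ι → (ι × ι → ℝ) → ℝ :=
    fun s m => Finset.univ.sup' Finset.univ_nonempty fun u => |(∫ y in A u, f s y) - m u|
    with hΔdef
  have hmin : ∀ m, ∃ s, ∀ u, Δ s m ≤ Δ u m := fun m => Finite.exists_min fun s => Δ s m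
  choose σ hσ using hmin
  -- The choice depends on the sample only through this finite membership pattern, so the arbitrary
  -- minimizer `σ` causes no measurability problem.
  set G : (Fin n → Fin d → ℝ) → Fin n → ι × ι → Prop := fun x i u => x i ∈ A u with hGdef
  set φ : (Fin n → ι × ι → Prop) → ι × ι → ℝ :=
    fun g u => (∑ i, if g i u then (1 : ℝ) else 0) / n with hφdef
  have hG : Measurable G := measurable_pi_lambda _ fun i => measurable_pi_lambda _ fun u =>
    (hA u).mem.comp (measurable_pi_apply i)
  have hφ : ∀ x u, φ (G x) u = freq (A u) x := by
    intro x u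
    simp [hφdef, hGdef, freq, Set.indicator_apply]
  let _ : MeasurableSpace ι := ⊤
  set τ : (Fin n → Fin d → ℝ) → ι := fun x => σ (φ (G x)) with hτdef
  have hτ : Measurable τ :=
    (measurable_of_countable fun g : Fin n → ι × ι → Prop => σ (φ g)).comp hG
  have hfj : Measurable fun z : ι × (Fin d → ℝ) => f z.1 z.2 :=
    measurable_from_prod_countable_right fun s => hfm s
  refine ⟨fun x => f (τ x),
    ⟨hfj.comp ((hτ.comp measurable_fst).prodMk measurable_snd), fun x => hf _⟩, ?_⟩
  intro p hp s t ht
  have hkey : {x | 5 * l1Dist (f s) p + 4 * t < l1Dist (f (τ x)) p} ⊆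
      ⋃ u : ι × ι, {x : Fin n → Fin d → ℝ | t < |freq (A u) x - ∫ y in A u, p y|} := by
    intro x hx
    by_contra hcon
    simp only [Set.mem_iUnion, Set.mem_ofPred_eq, not_exists, not_lt] at hcon hx
    have hs : Δ s (φ (G x)) ≤ l1Dist (f s) p + t := by
      refine Finset.sup'_le _ _ fun u _ => ?_
      rw [hφ]
      have h1 := abs_setIntegral_sub_le (hf s).1.1 hp.1 (A u)
      have h2 := hcon u
      rw [abs_sub_comm] at h2
      exact (abs_sub_le _ (∫ y in A u, p y) _).trans (add_le_add h1 h2)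
    have hτs : Δ (τ x) (φ (G x)) ≤ Δ s (φ (G x)) := hσ _ s
    have hle : ∀ r u, |(∫ y in A u, f r y) - φ (G x) u| ≤ Δ r (φ (G x)) := fun r u =>
      Finset.le_sup' (fun u => |(∫ y in A u, f r y) - φ (G x) u|) (Finset.mem_univ u)
    -- By Scheffé, the distance from `f (τ x)` to `f s` is at most `2 * (Δ (τ x) + Δ s) ≤ 4 * Δ s ≤
    -- 4 * (l1Dist (f s) p + t)`; the triangle inequality adds the fifth copy of `l1Dist (f s) p`.
    have h3 := l1Dist_eq_two_mul_setIntegral (hf (τ x)).1 (hf s).1 (hfm _) (hfm _)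
    have h4 := abs_le.1 (hle (τ x) (τ x, s))
    have h5 := abs_le.1 (hle s (τ x, s))
    have h6 := l1Dist_triangle (hf (τ x)).1.1 (hf s).1.1 hp.1
    linarith [h4.2, h5.1]
  refine (measure_mono hkey).trans ((measure_iUnion_fintype_le _ _).trans ?_)
  refine (Finset.sum_le_sum fun u _ => freq_deviation hn hp (hA u) ht).trans ?_
  rw [Finset.sum_const, Finset.card_univ, Fintype.card_prod, nsmul_eq_mul,
    ← ENNReal.ofReal_natCast, ← ENNReal.ofReal_mul (Nat.cast_nonneg _)]
  refine ENNReal.ofReal_le_ofReal (le_of_eq ?_)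
  push_cast
  ring

/-! ### Basic densities and measurable representatives. -/

theorem IsPdf.integral_abs {E : Type*} [MeasureSpace E] {p : E → ℝ} (hp : IsPdf p) :
    ∫ x, |p x| = 1 := by
  rw [← hp.2.2]
  exact integral_congr_ae (hp.2.1.mono fun x hx => abs_of_nonneg hx)

theorem isPdf_indicator_Icc {d : ℕ} :
    IsPdf ((Set.Icc (0 : Fin d → ℝ) 1).indicator fun _ => (1 : ℝ)) := by
  have hv : (volume : Measure (Fin d → ℝ)) (Set.Icc 0 1) = 1 := by
    rw [Real.volume_Icc_pi]; simp
  refine ⟨(integrable_indicator_iff measurableSet_Icc).2 ?_, ae_of_all _ fun x => ?_, ?_⟩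
  · exact integrableOn_const (by rw [hv]; exact ENNReal.one_ne_top)
  · exact Set.indicator_nonneg (fun _ _ => zero_le_one) x
  · rw [integral_indicator measurableSet_Icc, setIntegral_const, Measure.real, hv]
    simp

theorem indicator_Icc_mem_unitCubeDensities (d : ℕ) :
    ((Set.Icc (0 : Fin d → ℝ) 1).indicator fun _ => (1 : ℝ)) ∈ unitCubeDensities d :=
  ⟨isPdf_indicator_Icc, ae_of_all _ fun _ hx => Set.indicator_of_notMem hx _⟩

theorem isPdf_indicator_Icc_real : IsPdf ((Set.Icc (0 : ℝ) 1).indicator fun _ => (1 : ℝ)) := by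
  refine ⟨(integrable_indicator_iff measurableSet_Icc).2 (by simp),
    ae_of_all _ fun x => Set.indicator_nonneg (fun _ _ => zero_le_one) x, ?_⟩
  rw [integral_indicator measurableSet_Icc, setIntegral_const]
  simp

theorem mem_unitCubeDensities_congr {d : ℕ} {p q : (Fin d → ℝ) → ℝ}
    (hp : p ∈ unitCubeDensities d) (hae : p =ᵐ[volume] q) : q ∈ unitCubeDensities d := by
  obtain ⟨⟨hi, h0, h1⟩, hs⟩ := hp
  refine ⟨⟨hi.congr hae, ?_, ?_⟩, ?_⟩
  · filter_upwards [hae, h0] with x hx h; rwa [← hx]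
  · rw [← h1]; exact integral_congr_ae hae.symm
  · filter_upwards [hae, hs] with x hx h; rwa [← hx]

theorem exists_measurable_density {d : ℕ} {p : (Fin d → ℝ) → ℝ} (hp : p ∈ unitCubeDensities d) :
    ∃ f ∈ unitCubeDensities d, Measurable f ∧ p =ᵐ[volume] f :=
  have hm := hp.1.1.aestronglyMeasurable
  ⟨hm.mk p, mem_unitCubeDensities_congr hp hm.ae_eq_mk,
    hm.stronglyMeasurable_mk.measurable, hm.ae_eq_mk⟩

theorem l1Dist_congr_left {d : ℕ} {f g h : (Fin d → ℝ) → ℝ} (hfg : f =ᵐ[volume] g) :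
    l1Dist f h = l1Dist g h :=
  integral_congr_ae (hfg.mono fun x hx => by simp only [hx])

/-! ### Covering univariate Lipschitz densities. -/

/-- Nonnegative `Λ`-Lipschitz probability densities on the line that vanish off `[0,1]`. -/
structure IsUnitLipschitzPdf (Λ : ℝ≥0) (q : ℝ → ℝ) : Prop where
  isPdf : IsPdf q
  nonneg : ∀ x, 0 ≤ q x
  lipschitz : LipschitzWith Λ q
  eq_zero : ∀ x ∉ Set.Icc (0 : ℝ) 1, q x = 0

/-- Continuity forces `q 0 = 0`. The resulting bound by `Λ` on `[0,1]` is what leaves only `b + 1`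
possible codes per grid point. -/
theorem IsUnitLipschitzPdf.le_mul {Λ : ℝ≥0} {q : ℝ → ℝ} (hq : IsUnitLipschitzPdf Λ q) {x : ℝ}
    (hx : 0 ≤ x) : q x ≤ Λ * x := by
  have h0 : ∀ y < 0, q y = 0 := fun y hy => hq.eq_zero y fun h => (not_le.2 hy) h.1
  have hq0 : q 0 = 0 := by
    have h1 : Tendsto q (𝓝[<] 0) (𝓝 (q 0)) :=
      hq.lipschitz.continuous.continuousAt.tendsto.mono_left nhdsWithin_le_nhds
    have h2 : Tendsto q (𝓝[<] 0) (𝓝 0) :=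
      tendsto_const_nhds.congr' (eventually_nhdsWithin_of_forall fun y hy => (h0 y hy).symm)
    exact tendsto_nhds_unique h1 h2
  have := hq.lipschitz.dist_le_mul x 0
  rw [Real.dist_eq, Real.dist_eq, hq0, sub_zero, sub_zero, abs_of_nonneg hx] at this
  exact (le_abs_self _).trans this

theorem abs_sub_le_of_natFloor_eq {x y : ℝ} (hx : 0 ≤ x) (hy : 0 ≤ y) (h : ⌊x⌋₊ = ⌊y⌋₊) :
    |x - y| ≤ 1 := by
  have h1 := Nat.floor_le hx
  have h2 := Nat.lt_floor_add_one x
  have h3 := Nat.floor_le hy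
  have h4 := Nat.lt_floor_add_one y
  rw [h] at h1 h2
  rw [abs_le]; constructor <;> linarith

/-- Two Lipschitz densities with the same discretization are close. -/
theorem IsUnitLipschitzPdf.integral_abs_sub_le {Λ : ℝ≥0} (hΛ : 0 < Λ) {b : ℕ} (hb : 0 < b)
    {q r : ℝ → ℝ} (hq : IsUnitLipschitzPdf Λ q) (hr : IsUnitLipschitzPdf Λ r)
    (h : ∀ l < b, ⌊b * q (l / b) / Λ⌋₊ = ⌊b * r (l / b) / Λ⌋₊) :
    ∫ x, |q x - r x| ≤ 3 * Λ / b := by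
  have hb' : (0 : ℝ) < b := by exact_mod_cast hb
  have hΛ' : (0 : ℝ) < Λ := by exact_mod_cast hΛ
  -- Each of `q` and `r` moves by at most `Λ / b` between `x` and its grid point, and the equal
  -- floors contribute a third `Λ / b`. The point `1`, whose index would be `b`, is null.
  have hpt : ∀ x ∈ Set.Ico (0 : ℝ) 1, |q x - r x| ≤ 3 * Λ / b := by
    intro x hx
    set l := ⌊b * x⌋₊ with hl
    have hbx : 0 ≤ b * x := mul_nonneg hb'.le hx.1
    have hlb : l < b := (Nat.floor_lt hbx).2 (by nlinarith [hx.2])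
    have hdist : |x - l / b| ≤ 1 / b := by
      have h1 := Nat.floor_le hbx
      have h2 := Nat.lt_floor_add_one (b * x)
      rw [← hl] at h1 h2
      have : x - l / b = (b * x - l) / b := by field_simp
      rw [this, abs_div, abs_of_pos hb', abs_of_nonneg (by linarith)]
      gcongr
      linarith
    have hlip : ∀ {f : ℝ → ℝ}, LipschitzWith Λ f → |f x - f (l / b)| ≤ Λ * (1 / b) := by
      intro f hf
      have := hf.dist_le_mul x (l / b)
      rw [Real.dist_eq, Real.dist_eq] at this
      exact this.trans (by gcongr)
    have h1 := hlip hq.lipschitz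
    have h2 := hlip hr.lipschitz
    have h3 : |q (l / b) - r (l / b)| ≤ Λ * (1 / b) := by
      have := abs_sub_le_of_natFloor_eq (by have := hq.nonneg (l / b); positivity)
        (by have := hr.nonneg (l / b); positivity) (h l hlb)
      have e : q (l / b) - r (l / b)
          = Λ / b * (b * q (l / b) / Λ - b * r (l / b) / Λ) := by field_simp
      rw [e, abs_mul, abs_of_pos (by positivity)]
      calc _ ≤ Λ / b * (1 : ℝ) := by gcongr
        _ = _ := by ring
    have e : 3 * (Λ : ℝ) / b = Λ * (1 / b) + Λ * (1 / b) + Λ * (1 / b) := by ring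
    rw [e, abs_le]
    rw [abs_le] at h1 h2 h3
    constructor <;> linarith [h1.1, h1.2, h2.1, h2.2, h3.1, h3.2]
  have hae : ∀ᵐ x, |q x - r x| ≤ (Set.Ico (0 : ℝ) 1).indicator (fun _ => (3 * Λ / b : ℝ)) x := by
    have : ∀ᵐ x : ℝ, x ≠ 1 := by simp [ae_iff]
    filter_upwards [this] with x hx
    by_cases hx' : x ∈ Set.Ico (0 : ℝ) 1
    · rw [Set.indicator_of_mem hx']; exact hpt x hx'
    · have : x ∉ Set.Icc (0 : ℝ) 1 := fun h => hx' ⟨h.1, lt_of_le_of_ne h.2 hx⟩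
      rw [Set.indicator_of_notMem hx', hq.eq_zero x this, hr.eq_zero x this]
      simp
  calc ∫ x, |q x - r x| ≤ ∫ x, (Set.Ico (0 : ℝ) 1).indicator (fun _ => (3 * Λ / b : ℝ)) x :=
        integral_mono_ae (hq.isPdf.1.sub hr.isPdf.1).abs
          ((integrable_indicator_iff measurableSet_Ico).2 (by simp)) hae
    _ = 3 * Λ / b := by
        rw [integral_indicator measurableSet_Ico, setIntegral_const]
        simp

/-- One representative is kept per realized vector of rounded grid values; unrealized codes receive
the uniform density. -/
theorem exists_cover_unitLipschitzPdf {Λ : ℝ≥0} (hΛ : 0 < Λ) {b : ℕ} (hb : 0 < b) :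
    ∃ F : (Fin b → Fin (b + 1)) → ℝ → ℝ, (∀ s, IsPdf (F s)) ∧
      ∀ q, IsUnitLipschitzPdf Λ q → ∃ s, ∫ x, |q x - F s x| ≤ 3 * Λ / b := by
  classical
  have hb' : (0 : ℝ) < b := by exact_mod_cast hb
  have hΛ' : (0 : ℝ) < Λ := by exact_mod_cast hΛ
  set P : (Fin b → Fin (b + 1)) → (ℝ → ℝ) → Prop := fun s q =>
    IsUnitLipschitzPdf Λ q ∧ ∀ l : Fin b, ⌊b * q (l / b) / Λ⌋₊ = s l with hP
  refine ⟨fun s => if h : ∃ q, P s q then h.choose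
    else (Set.Icc (0 : ℝ) 1).indicator fun _ => 1, fun s => ?_, fun q hq => ?_⟩
  · dsimp only
    split_ifs with h
    · exact h.choose_spec.1.isPdf
    · exact isPdf_indicator_Icc_real
  · have hlt : ∀ l : Fin b, ⌊b * q (l / b) / Λ⌋₊ < b + 1 := by
      intro l
      rw [Nat.lt_succ_iff]
      refine Nat.floor_le_of_le ?_
      have h1 := hq.le_mul (x := l / b) (by positivity)
      have h2 : ((l : ℕ) : ℝ) ≤ b := by exact_mod_cast l.2.le
      rw [div_le_iff₀ hΛ', mul_le_mul_iff_right₀ hb']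
      refine h1.trans (mul_le_of_le_one_right hΛ'.le ?_)
      exact div_le_one_of_le₀ h2 hb'.le
    have h : ∃ r, P (fun l => ⟨_, hlt l⟩) r := ⟨q, hq, fun l => rfl⟩
    refine ⟨fun l => ⟨_, hlt l⟩, ?_⟩
    dsimp only
    rw [dif_pos h]
    exact hq.integral_abs_sub_le hΛ hb h.choose_spec.1
      fun l hl => (h.choose_spec.2 ⟨l, hl⟩).symm

/-! ### Products, mixtures and their covers. -/

theorem integrable_prod_of_isPdf {d : ℕ} {q : Fin d → ℝ → ℝ} (hq : ∀ j, IsPdf (q j)) :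
    Integrable fun x : Fin d → ℝ => ∏ j, q j (x j) :=
  Integrable.fintype_prod fun j => (hq j).1

theorem integral_abs_prod_of_isPdf {d : ℕ} {q : Fin d → ℝ → ℝ} (hq : ∀ j, IsPdf (q j)) :
    ∫ x : Fin d → ℝ, |∏ j, q j (x j)| = 1 := by
  simp_rw [Finset.abs_prod]
  rw [integral_fintype_prod_volume_eq_prod fun j y => |q j y|]
  exact Finset.prod_eq_one fun j _ => (hq j).integral_abs

/-- The `L¹` distance of product densities is subadditive over the coordinates. -/
theorem l1Dist_prod_le {d : ℕ} {q r : Fin d → ℝ → ℝ} (hq : ∀ j, IsPdf (q j))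
    (hr : ∀ j, IsPdf (r j)) :
    l1Dist (fun x => ∏ j, q j (x j)) (fun x => ∏ j, r j (x j))
      ≤ ∑ j, ∫ y, |q j y - r j y| := by
  -- Telescoping: the `i`-th term has factors `r` before `i`, the difference at `i`, and factors `q`
  -- after `i`. All factors but the `i`-th have integral one.
  set h : Fin d → Fin d → ℝ → ℝ := fun i j y =>
    if j < i then |r j y| else if j = i then |q j y - r j y| else |q j y| with hh
  have hint : ∀ i j, Integrable (h i j) := by
    intro i j
    simp only [hh]
    split_ifs
    · exact (hr j).1.abs
    · exact ((hq j).1.sub (hr j).1).abs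
    · exact (hq j).1.abs
  have hI : ∀ i, Integrable fun x : Fin d → ℝ => ∏ j, h i j (x j) := fun i =>
    Integrable.fintype_prod fun j => hint i j
  have hpt : ∀ x : Fin d → ℝ, |(∏ j, q j (x j)) - ∏ j, r j (x j)| ≤ ∑ i, ∏ j, h i j (x j) := by
    intro x
    have key := Finset.prod_sub_ordered (Finset.univ : Finset (Fin d)) (fun j => q j (x j))
      (fun j => q j (x j) - r j (x j))
    simp only [sub_sub_cancel] at key
    rw [key, sub_sub_cancel]
    refine (Finset.abs_sum_le_sum_abs _ _).trans (Finset.sum_le_sum fun i _ => le_of_eq ?_)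
    rw [abs_mul, abs_mul, Finset.abs_prod, Finset.abs_prod, Finset.prod_filter,
      Finset.prod_filter]
    have e : |q i (x i) - r i (x i)| = ∏ j, if j = i then |q j (x j) - r j (x j)| else 1 := by
      simp
    rw [e, ← Finset.prod_mul_distrib, ← Finset.prod_mul_distrib]
    refine Finset.prod_congr rfl fun j _ => ?_
    simp only [hh]
    rcases lt_trichotomy j i with hji | hji | hji
    · simp [hji, hji.ne, hji.not_gt]
    · simp [hji]
    · simp [hji, hji.ne', hji.not_gt]
  calc l1Dist (fun x => ∏ j, q j (x j)) (fun x => ∏ j, r j (x j))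
      ≤ ∫ x : Fin d → ℝ, ∑ i, ∏ j, h i j (x j) :=
        integral_mono ((integrable_prod_of_isPdf hq).sub (integrable_prod_of_isPdf hr)).abs
          (integrable_finsetSum _ fun i _ => hI i) hpt
    _ = ∑ i, ∏ j, ∫ y, h i j y := by
        rw [integral_finsetSum _ fun i _ => hI i]
        exact Finset.sum_congr rfl fun i _ => integral_fintype_prod_volume_eq_prod (h i)
    _ = ∑ j, ∫ y, |q j y - r j y| := by
        refine Finset.sum_congr rfl fun i _ => ?_
        rw [Finset.prod_eq_single i]
        · simp [hh]
        · intro j _ hj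
          simp only [hh, hj, if_false]
          split_ifs
          · exact (hr j).integral_abs
          · exact (hq j).integral_abs
        · simp

/-- `p` is within `τ` of a subconvex combination of `K` products of `Λ`-Lipschitz densities on the
unit interval. -/
def IsNearMixture {d : ℕ} (K : ℕ) (Λ : ℝ≥0) (τ : ℝ) (p : (Fin d → ℝ) → ℝ) : Prop :=
  ∃ (w : Fin K → ℝ) (q : Fin K → Fin d → ℝ → ℝ), (∀ i, 0 ≤ w i) ∧ ∑ i, w i ≤ 1 ∧
    (∀ i j, IsPdf (q i j)) ∧ (∀ i, w i ≠ 0 → ∀ j, IsUnitLipschitzPdf Λ (q i j)) ∧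
    l1Dist p (fun x => ∑ i, w i * ∏ j, q i j (x j)) ≤ τ

theorem integrable_mixture {d K : ℕ} (w : Fin K → ℝ) {q : Fin K → Fin d → ℝ → ℝ}
    (hq : ∀ i j, IsPdf (q i j)) :
    Integrable fun x : Fin d → ℝ => ∑ i, w i * ∏ j, q i j (x j) :=
  integrable_finsetSum _ fun i _ => (integrable_prod_of_isPdf (hq i)).const_mul _

theorem l1Dist_mixture_le {d K : ℕ} {w v : Fin K → ℝ} {q r : Fin K → Fin d → ℝ → ℝ}
    (hw : ∀ i, 0 ≤ w i) (hq : ∀ i j, IsPdf (q i j)) (hr : ∀ i j, IsPdf (r i j)) :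
    l1Dist (fun x => ∑ i, w i * ∏ j, q i j (x j)) (fun x => ∑ i, v i * ∏ j, r i j (x j))
      ≤ ∑ i, (w i * ∑ j, (∫ y, |q i j y - r i j y|) + |w i - v i|) := by
  have hQ := fun i => integrable_prod_of_isPdf (hq i)
  have hR := fun i => integrable_prod_of_isPdf (hr i)
  have hD : ∀ i, Integrable fun x : Fin d → ℝ =>
      |(∏ j, q i j (x j)) - ∏ j, r i j (x j)| := fun i => ((hQ i).sub (hR i)).abs
  have hI : ∀ i, Integrable fun x : Fin d → ℝ =>
      w i * |(∏ j, q i j (x j)) - ∏ j, r i j (x j)| + |w i - v i| * |∏ j, r i j (x j)| :=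
    fun i => ((hD i).const_mul _).add ((hR i).abs.const_mul _)
  have hpt : ∀ x : Fin d → ℝ,
      |(∑ i, w i * ∏ j, q i j (x j)) - ∑ i, v i * ∏ j, r i j (x j)| ≤
        ∑ i, (w i * |(∏ j, q i j (x j)) - ∏ j, r i j (x j)|
          + |w i - v i| * |∏ j, r i j (x j)|) := by
    intro x
    rw [← Finset.sum_sub_distrib]
    refine (Finset.abs_sum_le_sum_abs _ _).trans (Finset.sum_le_sum fun i _ => ?_)
    have e : w i * ∏ j, q i j (x j) - v i * ∏ j, r i j (x j)
        = w i * ((∏ j, q i j (x j)) - ∏ j, r i j (x j))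
          + (w i - v i) * ∏ j, r i j (x j) := by ring
    rw [e]
    refine (abs_add_le _ _).trans (le_of_eq ?_)
    rw [abs_mul, abs_mul, abs_of_nonneg (hw i)]
  refine (integral_mono ((integrable_mixture w hq).sub (integrable_mixture v hr)).abs
    (integrable_finsetSum _ fun i _ => hI i) hpt).trans ?_
  rw [integral_finsetSum _ fun i _ => hI i]
  refine Finset.sum_le_sum fun i _ => ?_
  rw [integral_add ((hD i).const_mul _) ((hR i).abs.const_mul _),
    integral_const_mul, integral_const_mul, integral_abs_prod_of_isPdf (hr i), mul_one]
  have := mul_le_mul_of_nonneg_left (l1Dist_prod_le (hq i) (hr i)) (hw i)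
  unfold l1Dist at this
  linarith

/-- Finite covers of the near-mixtures by measurable densities on the unit cube. -/
theorem exists_cover_nearMixture (d : ℕ) {K b : ℕ} (hK : 0 < K) (hb : 0 < b) {Λ : ℝ≥0}
    (hΛ : 0 < Λ) (τ : ℝ) :
    ∃ f : (Fin K → Fin (K * b + 1)) × (Fin K → Fin d → Fin b → Fin (b + 1)) →
        (Fin d → ℝ) → ℝ,
      (∀ s, f s ∈ unitCubeDensities d) ∧ (∀ s, Measurable (f s)) ∧
      ∀ p ∈ unitCubeDensities d, IsNearMixture K Λ τ p →
        ∃ s, l1Dist (f s) p ≤ 2 * (τ + (1 + 3 * d * Λ) / b) := by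
  classical
  have hb' : (0 : ℝ) < b := by exact_mod_cast hb
  have hK' : (0 : ℝ) < K := by exact_mod_cast hK
  obtain ⟨F, hF, hcov⟩ := exists_cover_unitLipschitzPdf hΛ hb
  set T := (Fin K → Fin (K * b + 1)) × (Fin K → Fin d → Fin b → Fin (b + 1))
  -- Weights are rounded down to multiples of `1 / (K * b)`, so that the `K` rounding errors add up
  -- to at most `1 / b`.
  set g : T → (Fin d → ℝ) → ℝ := fun t x =>
    ∑ i, ((t.1 i : ℕ) / (K * b) : ℝ) * ∏ j, F (t.2 i j) (x j) with hg
  have hgint : ∀ t, Integrable (g t) := fun t =>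
    integrable_mixture _ fun i j => hF (t.2 i j)
  set ε : ℝ := τ + (1 + 3 * d * Λ) / b with hε
  have happrox : ∀ p ∈ unitCubeDensities d, IsNearMixture K Λ τ p → ∃ t, l1Dist p (g t) ≤ ε := by
    rintro p hp ⟨w, q, hw, hw1, hq, hqL, hτ⟩
    have hs : ∀ i j, ∃ s, w i ≠ 0 → ∫ x, |q i j x - F s x| ≤ 3 * Λ / b := by
      intro i j
      by_cases h : w i = 0
      · exact ⟨fun _ => 0, fun h' => absurd h h'⟩
      · obtain ⟨s, hs⟩ := hcov _ (hqL i h j)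
        exact ⟨s, fun _ => hs⟩
    choose s hs using hs
    have hwi : ∀ i, w i ≤ 1 := fun i =>
      (Finset.single_le_sum (fun i _ => hw i) (Finset.mem_univ i)).trans hw1
    have hlt : ∀ i, ⌊w i * (K * b)⌋₊ < K * b + 1 := by
      intro i
      rw [Nat.lt_succ_iff]
      refine Nat.floor_le_of_le ?_
      push_cast
      exact mul_le_of_le_one_left (by positivity) (hwi i)
    refine ⟨(fun i => ⟨_, hlt i⟩, s), ?_⟩
    refine (l1Dist_triangle hp.1.1 (integrable_mixture w hq) (hgint _)).trans ?_
    refine add_le_add hτ ((l1Dist_mixture_le hw hq fun i j => hF _).trans ?_)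
    have hterm : ∀ i, w i * ∑ j, (∫ y, |q i j y - F (s i j) y|)
        + |w i - (⌊w i * (K * b)⌋₊ / (K * b) : ℝ)|
        ≤ w i * (d * (3 * Λ / b)) + 1 / (K * b) := by
      intro i
      refine add_le_add ?_ ?_
      · by_cases h : w i = 0
        · simp [h]
        · refine mul_le_mul_of_nonneg_left ?_ (hw i)
          refine (Finset.sum_le_sum fun j _ => hs i j h).trans (le_of_eq ?_)
          simp
      · have hkb : (0 : ℝ) < K * b := by positivity
        have h1 := Nat.floor_le (mul_nonneg (hw i) hkb.le)
        have h2 := Nat.lt_floor_add_one (w i * (K * b))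
        have e : w i - (⌊w i * (K * b)⌋₊ / (K * b) : ℝ)
            = (w i * (K * b) - ⌊w i * (K * b)⌋₊) / (K * b) := by field_simp
        rw [e, abs_div, abs_of_pos hkb, abs_of_nonneg (by linarith)]
        gcongr
        linarith
    refine (Finset.sum_le_sum fun i _ => hterm i).trans ?_
    rw [Finset.sum_add_distrib, ← Finset.sum_mul, Finset.sum_const, Finset.card_univ,
      Fintype.card_fin, nsmul_eq_mul]
    have h1 : (∑ i, w i) * (d * (3 * Λ / b)) ≤ 1 * (d * (3 * Λ / b) : ℝ) := by gcongr
    have h2 : (K : ℝ) * (1 / (K * b)) = 1 / b := by field_simp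
    rw [h2]
    refine (add_le_add_left h1 _).trans (le_of_eq ?_)
    ring
  -- Rounding the weights may destroy total mass one, so `g t` is replaced by a genuine density
  -- within `ε` of it, if there is one. This costs the factor `2` in the cover radius.
  have hsel : ∀ t, ∃ f ∈ unitCubeDensities d, Measurable f ∧
      ((∃ p ∈ unitCubeDensities d, l1Dist p (g t) ≤ ε) → l1Dist f (g t) ≤ ε) := by
    intro t
    by_cases h : ∃ p ∈ unitCubeDensities d, l1Dist p (g t) ≤ ε
    · obtain ⟨p, hp, hpε⟩ := h
      obtain ⟨f, hf, hfm, hae⟩ := exists_measurable_density hp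
      exact ⟨f, hf, hfm, fun _ => by rwa [← l1Dist_congr_left hae]⟩
    · obtain ⟨f, hf, hfm, -⟩ := exists_measurable_density (indicator_Icc_mem_unitCubeDensities d)
      exact ⟨f, hf, hfm, fun h' => absurd h' h⟩
  choose f hf hfm hfε using hsel
  refine ⟨f, hf, hfm, fun p hp hmix => ?_⟩
  obtain ⟨t, ht⟩ := happrox p hp hmix
  refine ⟨t, (l1Dist_triangle (hf t).1.1 (hgint t) hp.1.1).trans ?_⟩
  rw [l1Dist_comm (g t)]
  linarith [hfε t ⟨p, hp, ht⟩]

/-! ### Truncating a Lipschitz spectrum. -/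

theorem nonneg_of_continuous_of_ae_nonneg {q : ℝ → ℝ} (hq : Continuous q)
    (h : ∀ᵐ x, 0 ≤ q x) (x : ℝ) : 0 ≤ q x := by
  have hcl : IsClosed {x | 0 ≤ q x} := isClosed_le continuous_const hq
  have := (Measure.dense_of_ae h).closure_eq
  rw [hcl.closure_eq] at this
  exact this.symm.subset (Set.mem_univ x)

theorem IsPdf.exists_ne_zero {E : Type*} [MeasureSpace E] {p : E → ℝ} (hp : IsPdf p) :
    ∃ x, p x ≠ 0 := by
  by_contra! h
  have := hp.2.2
  simp [h] at this

/-- The factors of a product density supported on the unit cube vanish off the unit interval. -/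
theorem factor_eq_zero {d : ℕ} {q : Fin d → ℝ → ℝ} (hc : ∀ j, Continuous (q j))
    (hq : ∀ j, IsPdf (q j))
    (h : ∀ᵐ x : Fin d → ℝ, x ∉ Set.Icc (0 : Fin d → ℝ) 1 → ∏ j, q j (x j) = 0)
    (j : Fin d) {y : ℝ} (hy : y ∉ Set.Icc (0 : ℝ) 1) : q j y = 0 := by
  choose z hz using fun j => (hq j).exists_ne_zero
  have hcont : Continuous fun x : Fin d → ℝ => ∏ j, q j (x j) :=
    continuous_finsetProd _ fun j _ => (hc j).comp (continuous_apply j)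
  have hopen : IsOpen (Set.Icc (0 : Fin d → ℝ) 1)ᶜ := isClosed_Icc.isOpen_compl
  have heq := Measure.eqOn_open_of_ae_eq (μ := (volume : Measure (Fin d → ℝ)))
    (f := fun x => ∏ j, q j (x j)) (g := fun _ => 0)
    ((ae_restrict_iff' hopen.measurableSet).2 h) hopen hcont.continuousOn continuousOn_const
  -- This point lies off the cube and every factor except possibly the `j`-th is nonzero there, so
  -- the vanishing product forces `q j y = 0`.
  set x := Function.update z j y with hx
  have hxmem : x ∈ (Set.Icc (0 : Fin d → ℝ) 1)ᶜ := by
    intro hmem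
    have h1 := hmem.1 j
    have h2 := hmem.2 j
    simp only [hx, Function.update_self, Pi.zero_apply, Pi.one_apply] at h1 h2
    exact hy ⟨h1, h2⟩
  have hprod := heq hxmem
  obtain ⟨i, -, hi⟩ := Finset.prod_eq_zero_iff.1 hprod
  by_cases hij : i = j
  · subst hij
    simpa [hx] using hi
  · simp only [hx, Function.update_of_ne hij] at hi
    exact absurd hi (hz i)

/-- Nonnegative terms cannot cancel, so every component of nonzero weight vanishes off the cube
along with `p`, and its factors live on `[0,1]`. The components `0, …, K` are kept; the partial sum
lies below `p`, so the `L¹` error is exactly the weight of the tail. -/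
theorem isNearMixture_of_mem_NLClass {d : ℕ} {W Lt : ℕ → ℝ} (hLt : Monotone Lt)
    {p : (Fin d → ℝ) → ℝ} (hp : p ∈ unitCubeDensities d ∩ NLClass d W Lt) (K : ℕ) {Λ : ℝ≥0}
    (hΛ : Lt K ≤ Λ) : IsNearMixture (K + 1) Λ (W K) p := by
  obtain ⟨⟨hpdf, hsupp⟩, -, w, L, ⟨hw, -, hw1, q, hq, hsum⟩, hL, htail⟩ := hp
  have hc : ∀ i j, Continuous (q i j) := fun i j => (hq i j).2.continuous
  have hnn : ∀ i j x, 0 ≤ q i j x := fun i j =>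
    nonneg_of_continuous_of_ae_nonneg (hc i j) (hq i j).1.2.1
  have hterm : ∀ i (x : Fin d → ℝ), 0 ≤ w i * ∏ j, q i j (x j) := fun i x =>
    mul_nonneg (hw i) (Finset.prod_nonneg fun j _ => hnn i j _)
  have hzero : ∀ i, w i ≠ 0 →
      ∀ᵐ x : Fin d → ℝ, x ∉ Set.Icc (0 : Fin d → ℝ) 1 → ∏ j, q i j (x j) = 0 := by
    intro i hi
    filter_upwards [hsupp, hsum] with x hx hs hmem
    have h1 := le_hasSum hs i fun k _ => hterm k x
    rw [hx hmem] at h1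
    exact (mul_eq_zero.1 (le_antisymm h1 (hterm i x))).resolve_left hi
  have hpartial : (∑ i ∈ Finset.range (K + 1), w i) + ∑' i, w (K + 1 + i) = 1 := by
    have := hw1.summable.sum_add_tsum_nat_add (K + 1)
    rw [hw1.tsum_eq] at this
    simpa only [add_comm] using this
  have htnn : 0 ≤ ∑' i, w (K + 1 + i) := tsum_nonneg fun i => hw _
  refine ⟨fun i => w i, fun i => q i, fun i => hw i, ?_, fun i j => (hq i j).1, ?_, ?_⟩
  · rw [Fin.sum_univ_eq_sum_range]
    linarith
  · intro i hi j
    refine ⟨(hq i j).1, hnn i j, (hq i j).2.weaken ?_, fun y hy =>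
      factor_eq_zero (hc i) (fun j => (hq i j).1) (hzero i hi) j hy⟩
    have : ((L i : ℝ)) ≤ Λ :=
      (hL i).trans ((hLt (Nat.lt_succ_iff.1 i.2)).trans hΛ)
    exact_mod_cast this
  · set S : (Fin d → ℝ) → ℝ := fun x => ∑ i : Fin (K + 1), w i * ∏ j, q i j (x j) with hS
    have hSint : Integrable S :=
      integrable_mixture (fun i : Fin (K + 1) => w i) (q := fun i => q i) fun i j => (hq i j).1
    have hle : ∀ᵐ x, S x ≤ p x := by
      filter_upwards [hsum] with x hs
      rw [hS]
      dsimp only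
      rw [Fin.sum_univ_eq_sum_range fun i => w i * ∏ j, q i j (x j)]
      exact sum_le_hasSum _ (fun i _ => hterm i x) hs
    have hSI : ∫ x, S x = ∑ i ∈ Finset.range (K + 1), w i := by
      rw [hS, integral_finsetSum _ fun (i : Fin (K + 1)) _ =>
        (integrable_prod_of_isPdf fun j => (hq i j).1).const_mul _,
        ← Fin.sum_univ_eq_sum_range]
      refine Finset.sum_congr rfl fun i _ => ?_
      rw [integral_const_mul, integral_fintype_prod_volume_eq_prod (q i),
        Finset.prod_eq_one fun j _ => (hq i j).1.2.2, mul_one]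
    have : l1Dist p S = ∫ x, (p x - S x) :=
      integral_congr_ae (hle.mono fun x hx => abs_of_nonneg (sub_nonneg.2 hx))
    rw [this, integral_sub hpdf.1 hSint, hpdf.2.2, hSI]
    linarith [htail K]

/-! ### A countable dense family. -/

/-- The densities on the unit cube have a countable dense subset for the `L¹` distance. -/
theorem exists_dense_seq (d : ℕ) :
    ∃ f : ℕ → (Fin d → ℝ) → ℝ, (∀ m, f m ∈ unitCubeDensities d) ∧ (∀ m, Measurable (f m)) ∧
      ∀ p ∈ unitCubeDensities d, ∀ ε : ℝ, 0 < ε → ∃ m, l1Dist (f m) p < ε := by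
  set S : Set (Lp ℝ 1 (volume : Measure (Fin d → ℝ))) := {u | ⇑u ∈ unitCubeDensities d} with hS
  have : Fact ((1 : ℝ≥0∞) ≠ ⊤) := ⟨ENNReal.one_ne_top⟩
  have htoL1 : ∀ {p : (Fin d → ℝ) → ℝ} (hp : p ∈ unitCubeDensities d), hp.1.1.toL1 p ∈ S :=
    fun hp => mem_unitCubeDensities_congr hp hp.1.1.coeFn_toL1.symm
  have : Nonempty S := ⟨⟨_, htoL1 (indicator_Icc_mem_unitCubeDensities d)⟩⟩
  -- Subsets of the separable metric space `L¹` are separable, so the dense sequence can be taken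
  -- inside the densities.
  obtain ⟨u, hu⟩ := TopologicalSpace.exists_dense_seq S
  choose f hf hfm hfae using fun m => exists_measurable_density (u m).2
  refine ⟨f, hf, hfm, fun p hp ε hε => ?_⟩
  obtain ⟨m, hm⟩ := hu.exists_dist_lt ⟨_, htoL1 hp⟩ hε
  refine ⟨m, lt_of_le_of_lt (le_of_eq ?_) hm⟩
  rw [dist_comm, Subtype.dist_eq, L1.dist_eq_integral_dist]
  refine integral_congr_ae ?_
  filter_upwards [hfae m, hp.1.1.coeFn_toL1] with x hx hx'
  rw [← hx, hx', Real.dist_eq]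

/-! ### Selection from growing families. -/

theorem errorProb_anti {d : ℕ} (V : (n : ℕ) → (Fin n → Fin d → ℝ) → (Fin d → ℝ) → ℝ)
    (p : (Fin d → ℝ) → ℝ) (n : ℕ) {s t : ℝ} (h : s ≤ t) :
    errorProb V p n t ≤ errorProb V p n s :=
  measure_mono fun _ hx => lt_of_le_of_lt h hx

/-- The stochastic error of the minimum distance estimator for `N` densities and `n`
observations. -/
noncomputable def selectionError (N n : ℕ) : ℝ := √((Real.log N + Real.log (n + 1)) / n)

/-- At this threshold the exponential equals `(N * (n + 1)) ^ (-2)`, which absorbs the `N ^ 2` of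
the union bound. -/
theorem selection_prob_le {N n : ℕ} (hN : 0 < N) (hn : 0 < n) :
    2 * (N : ℝ) ^ 2 * Real.exp (-2 * n * selectionError N n ^ 2) ≤ 2 * (1 / ((n : ℝ) + 1)) := by
  have hN' : (0 : ℝ) < N := by exact_mod_cast hN
  have hn' : (0 : ℝ) < n := by exact_mod_cast hn
  have h1 : 0 ≤ Real.log N := Real.log_natCast_nonneg N
  have h2 : 0 ≤ Real.log ((n : ℝ) + 1) := Real.log_nonneg (by linarith)
  have e : -2 * n * selectionError N n ^ 2
      = -(Real.log N + Real.log N + (Real.log ((n : ℝ) + 1) + Real.log ((n : ℝ) + 1))) := by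
    rw [selectionError, Real.sq_sqrt (by positivity)]
    field_simp
    ring
  rw [e, Real.exp_neg, Real.exp_add, Real.exp_add, Real.exp_add, Real.exp_log hN',
    Real.exp_log (by positivity)]
  have e2 : 2 * (N : ℝ) ^ 2 * ((N : ℝ) * N * (((n : ℝ) + 1) * ((n : ℝ) + 1)))⁻¹
      = 2 * (1 / ((n : ℝ) + 1)) * (1 / ((n : ℝ) + 1)) := by field_simp
  rw [e2]
  exact mul_le_of_le_one_right (by positivity)
    (div_le_one_of_le₀ (by linarith) (by positivity))

/-- Minimum distance estimation over a sequence of finite families of densities. -/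
theorem exists_estimator_sequence {d : ℕ} (ι : ℕ → Type) [∀ n, Fintype (ι n)]
    [∀ n, Nonempty (ι n)] (f : ∀ n, ι n → (Fin d → ℝ) → ℝ)
    (hf : ∀ n s, f n s ∈ unitCubeDensities d) (hfm : ∀ n s, Measurable (f n s)) :
    ∃ V : (n : ℕ) → (Fin n → Fin d → ℝ) → (Fin d → ℝ) → ℝ, (∀ n, IsEstimator (V n)) ∧
      ∀ p, IsPdf p → ∀ r : ℕ → ℝ, (∀ᶠ n in atTop, ∃ s, l1Dist (f n s) p ≤ r n) →
        Tendsto (fun n => errorProb V p n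
          (5 * r n + 4 * selectionError (Fintype.card (ι n)) n)) atTop (𝓝 0) := by
  have hV : ∀ n, ∃ V : (Fin n → Fin d → ℝ) → (Fin d → ℝ) → ℝ, IsEstimator V ∧ (0 < n →
      ∀ p : (Fin d → ℝ) → ℝ, IsPdf p → ∀ (s : ι n) (t : ℝ), 0 ≤ t →
        sampleLaw p n {x | 5 * l1Dist (f n s) p + 4 * t < l1Dist (V x) p}
          ≤ ENNReal.ofReal
            (2 * (Fintype.card (ι n) : ℝ) ^ 2 * Real.exp (-2 * n * t ^ 2))) := by
    intro n
    rcases Nat.eq_zero_or_pos n with h | h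
    · have s : ι n := Classical.arbitrary _
      exact ⟨fun _ => f n s, ⟨(hfm n s).comp measurable_snd, fun _ => hf n s⟩,
        fun h' => absurd h h'.ne'⟩
    · obtain ⟨V, h1, h2⟩ := exists_minimumDistance_estimator h (hf n) (hfm n)
      exact ⟨V, h1, fun _ => h2⟩
  choose V hV hprob using hV
  refine ⟨V, hV, fun p hp r hr => ?_⟩
  have hlim : Tendsto (fun n : ℕ => ENNReal.ofReal (2 * (1 / ((n : ℝ) + 1)))) atTop (𝓝 0) := by
    have := (tendsto_one_div_add_atTop_nhds_zero_nat (𝕜 := ℝ)).const_mul 2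
    rw [mul_zero] at this
    simpa using ENNReal.tendsto_ofReal this
  refine tendsto_of_tendsto_of_tendsto_of_le_of_le' tendsto_const_nhds hlim
    (Eventually.of_forall fun _ => zero_le) ?_
  filter_upwards [hr, eventually_gt_atTop 0] with n ⟨s, hs⟩ hn
  refine (errorProb_anti V p n
    (s := 5 * l1Dist (f n s) p + 4 * selectionError (Fintype.card (ι n)) n) (by linarith)).trans ?_
  exact (hprob n hn p hp s _ (Real.sqrt_nonneg _)).trans
    (ENNReal.ofReal_le_ofReal (selection_prob_le Fintype.card_pos hn))

/-! ### Family sizes and rates. -/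

/-- A positive integer of the order of `n ^ γ`. -/
noncomputable def succFloorRpow (γ : ℝ) (n : ℕ) : ℕ := ⌊(n : ℝ) ^ γ⌋₊ + 1

theorem rpow_le_succFloorRpow (γ : ℝ) (n : ℕ) : (n : ℝ) ^ γ ≤ succFloorRpow γ n := by
  unfold succFloorRpow
  push_cast
  exact (Nat.lt_floor_add_one _).le

theorem succFloorRpow_le {γ : ℝ} (hγ : 0 ≤ γ) {n : ℕ} (hn : 1 ≤ n) :
    (succFloorRpow γ n : ℝ) ≤ 2 * (n : ℝ) ^ γ := by
  have hn' : (1 : ℝ) ≤ n := by exact_mod_cast hn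
  have h1 := Real.one_le_rpow hn' hγ
  have h2 := Nat.floor_le (zero_le_one.trans h1)
  unfold succFloorRpow
  push_cast
  linarith

theorem succFloorRpow_pos (γ : ℝ) (n : ℕ) : 0 < succFloorRpow γ n := Nat.succ_pos _

/-- The size of the family of densities used for `n` observations. -/
theorem log_familySize_le (d K b n : ℕ) (hK : 0 < K) (hb : 0 < b) :
    Real.log (((K * b + 1) ^ K * (((b + 1) ^ b) ^ d) ^ K + (n + 1) : ℕ))
      ≤ (K * b * (d + 1) : ℕ) * Real.log ((K * b : ℕ) + 1) + Real.log (n + 2) := by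
  have hbK : b + 1 ≤ K * b + 1 := by nlinarith
  have h1 : (K * b + 1) ^ K * (((b + 1) ^ b) ^ d) ^ K ≤ (K * b + 1) ^ (K * b * (d + 1)) := by
    calc (K * b + 1) ^ K * (((b + 1) ^ b) ^ d) ^ K
        ≤ (K * b + 1) ^ (K * b) * (((K * b + 1) ^ b) ^ d) ^ K := by
          gcongr
          · omega
          · nlinarith
      _ = (K * b + 1) ^ (K * b * (d + 1)) := by
          rw [← pow_mul, ← pow_mul, ← pow_add]; ring_nf
  have h2 : 1 ≤ (K * b + 1) ^ (K * b * (d + 1)) := Nat.one_le_pow _ _ (Nat.succ_pos _)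
  have h3 : (K * b + 1) ^ K * (((b + 1) ^ b) ^ d) ^ K + (n + 1)
      ≤ (K * b + 1) ^ (K * b * (d + 1)) * (n + 2) := by nlinarith
  have h4 : (((K * b + 1) ^ K * (((b + 1) ^ b) ^ d) ^ K + (n + 1) : ℕ) : ℝ)
      ≤ (((K * b : ℕ) : ℝ) + 1) ^ (K * b * (d + 1)) * (n + 2) := by exact_mod_cast h3
  refine (Real.log_le_log (by positivity) h4).trans (le_of_eq ?_)
  rw [Real.log_mul (by positivity) (by positivity), Real.log_pow]

/-- The logarithm of the family size is of order `K * b * log n`, and `K * b` is of order `n ^ θ`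
with `θ = 1 - 2 * ρ`; dividing by `n` and taking the root leaves `n ^ (-ρ)`. -/
theorem selectionError_le {γ δ ρ : ℝ} (hγ : 0 < γ) (hδ : 0 < δ) (hρ : 0 ≤ ρ)
    (hθ : γ * (1 + δ) = 1 - 2 * ρ) (d : ℕ) :
    ∃ C : ℝ, ∀ n : ℕ, 3 ≤ n → ∀ K b : ℕ, K = succFloorRpow γ n → b = succFloorRpow δ K →
      selectionError ((K * b + 1) ^ K * (((b + 1) ^ b) ^ d) ^ K + (n + 1)) n
        ≤ C * ((n : ℝ) ^ (-ρ) * Real.log n) := by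
  set θ := γ * (1 + δ) with hθdef
  have hθ0 : 0 < θ := by positivity
  have hθ1 : θ ≤ 1 := by linarith
  -- `c` bounds `K * b / n ^ θ`: one `2` comes from rounding `b`, and `2 ^ (1 + δ)` from rounding
  -- `K`. The `4` in `D` pays for `log (n + 2) + log (n + 1)`.
  set c : ℝ := 2 * 2 ^ (1 + δ) with hc
  have hc0 : 0 < c := by positivity
  set D : ℝ := c * (d + 1) * (Real.log (c + 1) + 1) + 4 with hD
  have hlogc : 0 ≤ Real.log (c + 1) := Real.log_nonneg (by linarith)
  have hD0 : 0 ≤ D := by positivity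
  refine ⟨√D, ?_⟩
  rintro n hn K b hK hb
  have hn3 : (3 : ℝ) ≤ n := by exact_mod_cast hn
  have hn0 : (0 : ℝ) < n := by linarith
  have hlog : 1 ≤ Real.log n := by
    rw [Real.le_log_iff_exp_le hn0]
    exact (Real.exp_one_lt_d9.le.trans (by norm_num)).trans hn3
  have hKpos : 0 < K := hK ▸ succFloorRpow_pos _ _
  have hbpos : 0 < b := hb ▸ succFloorRpow_pos _ _
  have hK0 : (0 : ℝ) < K := by exact_mod_cast hKpos
  have hKle : (K : ℝ) ≤ 2 * (n : ℝ) ^ γ := hK ▸ succFloorRpow_le hγ.le (by omega)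
  have hble : (b : ℝ) ≤ 2 * (K : ℝ) ^ δ := hb ▸ succFloorRpow_le hδ.le hKpos
  have hnθ : 1 ≤ (n : ℝ) ^ θ := Real.one_le_rpow (by linarith) hθ0.le
  have hKb : ((K * b : ℕ) : ℝ) ≤ c * (n : ℝ) ^ θ := by
    push_cast
    calc (K : ℝ) * b ≤ K * (2 * (K : ℝ) ^ δ) := by gcongr
      _ = 2 * (K : ℝ) ^ (1 + δ) := by rw [Real.rpow_add hK0, Real.rpow_one]; ring
      _ ≤ 2 * (2 * (n : ℝ) ^ γ) ^ (1 + δ) := by gcongr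
      _ = c * (n : ℝ) ^ θ := by
          rw [Real.mul_rpow (by norm_num) (by positivity), ← Real.rpow_mul hn0.le]; ring
  have hlogKb : Real.log ((K * b : ℕ) + 1) ≤ (Real.log (c + 1) + 1) * Real.log n := by
    have h1 : ((K * b : ℕ) : ℝ) + 1 ≤ (c + 1) * n := by
      have : (n : ℝ) ^ θ ≤ n := by
        calc (n : ℝ) ^ θ ≤ (n : ℝ) ^ (1 : ℝ) := Real.rpow_le_rpow_of_exponent_le (by linarith) hθ1
          _ = n := Real.rpow_one _
      nlinarith
    refine (Real.log_le_log (by positivity) h1).trans ?_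
    rw [Real.log_mul (by positivity) hn0.ne']
    nlinarith
  have hlog2 : Real.log ((n : ℝ) + 2) ≤ 2 * Real.log n := by
    rw [← Real.log_rpow hn0]
    refine Real.log_le_log (by positivity) ?_
    rw [show (2 : ℝ) = ((2 : ℕ) : ℝ) by norm_num, Real.rpow_natCast]
    push_cast
    nlinarith
  have hlog1 : Real.log ((n : ℝ) + 1) ≤ 2 * Real.log n :=
    (Real.log_le_log (by positivity) (by linarith)).trans hlog2
  have hsum : Real.log (((K * b + 1) ^ K * (((b + 1) ^ b) ^ d) ^ K + (n + 1) : ℕ))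
      + Real.log (n + 1) ≤ D * (n : ℝ) ^ θ * Real.log n := by
    have h1 := log_familySize_le d K b n hKpos hbpos
    have h2 : ((K * b * (d + 1) : ℕ) : ℝ) * Real.log ((K * b : ℕ) + 1)
        ≤ (c * (n : ℝ) ^ θ * (d + 1)) * ((Real.log (c + 1) + 1) * Real.log n) := by
      have h0 : 0 ≤ Real.log (((K * b : ℕ) : ℝ) + 1) :=
        Real.log_nonneg (by have : (0 : ℝ) ≤ ((K * b : ℕ) : ℝ) := Nat.cast_nonneg _; linarith)
      refine mul_le_mul ?_ hlogKb h0 (by positivity)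
      rw [Nat.cast_mul _ (d + 1)]
      push_cast at hKb ⊢
      gcongr
    have h3 : Real.log n ≤ (n : ℝ) ^ θ * Real.log n := le_mul_of_one_le_left (by linarith) hnθ
    calc _ ≤ (c * (n : ℝ) ^ θ * (d + 1)) * ((Real.log (c + 1) + 1) * Real.log n)
          + 4 * ((n : ℝ) ^ θ * Real.log n) := by linarith
      _ = _ := by rw [hD]; ring
  rw [selectionError, Real.sqrt_le_left (by positivity), mul_pow, Real.sq_sqrt hD0]
  rw [div_le_iff₀ hn0]
  refine hsum.trans ?_
  have e : (n : ℝ) ^ θ = ((n : ℝ) ^ (-ρ)) ^ 2 * n := by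
    rw [← Real.rpow_natCast, ← Real.rpow_mul hn0.le]
    nth_rewrite 3 [← Real.rpow_one (n : ℝ)]
    rw [← Real.rpow_add hn0, hθ]
    congr 1
    push_cast
    ring
  rw [e, mul_pow]
  have h4 : Real.log n ≤ Real.log n ^ 2 := by nlinarith
  calc _ = D * ((n : ℝ) ^ (-ρ)) ^ 2 * n * Real.log n := by ring
    _ ≤ D * ((n : ℝ) ^ (-ρ)) ^ 2 * n * Real.log n ^ 2 := by gcongr
    _ = _ := by ring

/-- The approximation error of the family used for `n` observations. -/
theorem coverError_le {α β ℓ : ℝ} (hβ : 0 < β) (hℓ : 0 ≤ ℓ) (d : ℕ) {K : ℕ}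
    (hK : 0 < K) :
    2 * (ℓ * (K : ℝ) ^ (-α)
      + (1 + 3 * d * ((ℓ + 1) * (K : ℝ) ^ β)) / (succFloorRpow (α + β) K : ℝ))
      ≤ 2 * (1 + 3 * d) * (ℓ + 1) * (K : ℝ) ^ (-α) := by
  have hK0 : (0 : ℝ) < K := by exact_mod_cast hK
  have hK1 : (1 : ℝ) ≤ K := by exact_mod_cast hK
  have hb := rpow_le_succFloorRpow (α + β) K
  have hpos : 0 < (K : ℝ) ^ (α + β) := by positivity
  have h1 : 1 ≤ (K : ℝ) ^ β := Real.one_le_rpow hK1 hβ.le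
  have h2 : (K : ℝ) ^ (-α) = (K : ℝ) ^ β / (K : ℝ) ^ (α + β) := by
    rw [← Real.rpow_sub hK0]; ring_nf
  have h3 : (1 + 3 * d * ((ℓ + 1) * (K : ℝ) ^ β)) / (succFloorRpow (α + β) K : ℝ)
      ≤ (K : ℝ) ^ (-α) + 3 * d * (ℓ + 1) * (K : ℝ) ^ (-α) := by
    calc _ ≤ ((K : ℝ) ^ β + 3 * d * ((ℓ + 1) * (K : ℝ) ^ β)) / (K : ℝ) ^ (α + β) := by gcongr
      _ = _ := by rw [h2]; ring
  calc _ ≤ 2 * (ℓ * (K : ℝ) ^ (-α)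
        + ((K : ℝ) ^ (-α) + 3 * d * (ℓ + 1) * (K : ℝ) ^ (-α))) := by gcongr
    _ = _ := by ring

/-- Since `log n` eventually exceeds any implied constant, the construction can depend on `α`, `β`,
`d` alone. The index `⌊n ^ γ⌋₊` is one less than the number of components kept. -/
theorem eventually_le_log_mul {g : ℕ → ℝ} {e γ : ℝ} (hγ : 0 < γ)
    (hg : g =O[atTop] fun k : ℕ => ((k : ℝ) + 1) ^ e) :
    ∀ᶠ n : ℕ in atTop,
      g ⌊(n : ℝ) ^ γ⌋₊ ≤ Real.log n * (succFloorRpow γ n : ℝ) ^ e := by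
  obtain ⟨c, hc⟩ := hg.bound
  have hk : Tendsto (fun n : ℕ => ⌊(n : ℝ) ^ γ⌋₊) atTop atTop :=
    tendsto_nat_floor_atTop.comp ((tendsto_rpow_atTop hγ).comp tendsto_natCast_atTop_atTop)
  have hlog : Tendsto (fun n : ℕ => Real.log n) atTop atTop :=
    Real.tendsto_log_atTop.comp tendsto_natCast_atTop_atTop
  filter_upwards [hk.eventually hc, hlog.eventually_ge_atTop c] with n h1 h2
  have hpos : (0 : ℝ) ≤ ((⌊(n : ℝ) ^ γ⌋₊ : ℝ) + 1) ^ e := by positivity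
  rw [Real.norm_of_nonneg hpos] at h1
  refine (le_abs_self _).trans (h1.trans ?_)
  unfold succFloorRpow
  push_cast
  gcongr

end NLSpectrum

/-! ### Choice of parameters and conclusion. -/

open NLSpectrum in
theorem proposition1 (α β : ℝ) (hα : 0 < α) (hβ : 0 < β) (d : ℕ) (hd : 1 ≤ d) :
    ∃ V : (n : ℕ) → (Fin n → Fin d → ℝ) → (Fin d → ℝ) → ℝ,
      (∀ n, NLSpectrum.IsEstimator (V n)) ∧
      (∀ p ∈ NLSpectrum.unitCubeDensities d, NLSpectrum.ConsistentAt V p) ∧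
      ∀ W L : ℕ → ℝ, NLSpectrum.IsNLParam W L →
        (W =O[atTop] fun k : ℕ => ((k : ℝ) + 1) ^ (-α)) →
        (L =O[atTop] fun k : ℕ => ((k : ℝ) + 1) ^ β) →
        ∀ p ∈ NLSpectrum.unitCubeDensities d ∩ NLSpectrum.NLClass d W L,
          NLSpectrum.SoftORateAt V p
            (fun n : ℕ => (n : ℝ) ^ (-(α / (3 * α + β + 1)))) := by
  have hs : 0 < 3 * α + β + 1 := by positivity
  set γ : ℝ := 1 / (3 * α + β + 1) with hγdef
  set ρ : ℝ := α / (3 * α + β + 1) with hρdef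
  have hγ : 0 < γ := by positivity
  have hρ : 0 < ρ := by positivity
  have hθ : γ * (1 + (α + β)) = 1 - 2 * ρ := by rw [hγdef, hρdef]; field_simp; ring
  set K : ℕ → ℕ := succFloorRpow γ with hKdef
  set b : ℕ → ℕ := fun n => succFloorRpow (α + β) (K n) with hbdef
  have hK : ∀ n, 0 < K n := fun n => succFloorRpow_pos _ _
  have hb : ∀ n, 0 < b n := fun n => succFloorRpow_pos _ _
  have hlog : ∀ n : ℕ, 0 ≤ Real.log n := Real.log_natCast_nonneg
  -- The `+ 1` keeps `Λ n` positive when `log n = 0`.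
  set Λ : ℕ → ℝ≥0 := fun n => Real.toNNReal ((Real.log n + 1) * (K n : ℝ) ^ β) with hΛdef
  have hΛpos : ∀ n : ℕ, 0 < (Real.log n + 1) * (K n : ℝ) ^ β := fun n => by
    have h1 := hlog n
    have h2 : (0 : ℝ) < K n := by exact_mod_cast hK n
    positivity
  have hΛ : ∀ n, 0 < Λ n := fun n => Real.toNNReal_pos.2 (hΛpos n)
  have hΛcoe : ∀ n, (Λ n : ℝ) = (Real.log n + 1) * (K n : ℝ) ^ β := fun n =>
    Real.coe_toNNReal _ (hΛpos n).le
  choose f hf hfm hcov using fun n => exists_cover_nearMixture d (hK n) (hb n) (hΛ n)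
    (Real.log n * (K n : ℝ) ^ (-α))
  obtain ⟨u, hu, hum, hdense⟩ := exists_dense_seq d
  set ι : ℕ → Type := fun n =>
    ((Fin (K n) → Fin (K n * b n + 1)) × (Fin (K n) → Fin d → Fin (b n) → Fin (b n + 1)))
      ⊕ Fin (n + 1) with hι
  set F : ∀ n, ι n → (Fin d → ℝ) → ℝ := fun n => Sum.elim (f n) (fun m => u m) with hF
  obtain ⟨V, hV, hprob⟩ := exists_estimator_sequence ι F
    (fun n s => by cases s with | inl t => exact hf n t | inr m => exact hu m)
    (fun n s => by cases s with | inl t => exact hfm n t | inr m => exact hum m)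
  obtain ⟨C, hC⟩ := selectionError_le hγ (add_pos hα hβ) hρ.le hθ d
  have hsel : ∀ᶠ n : ℕ in atTop, selectionError (Fintype.card (ι n)) n
      ≤ C * ((n : ℝ) ^ (-ρ) * Real.log n) := by
    filter_upwards [eventually_ge_atTop 3] with n hn
    have := hC n hn (K n) (b n) rfl rfl
    simpa [hι] using this
  refine ⟨V, hV, fun p hp ε hε => ?_, fun W L hWL hW hL p hp => ?_⟩
  · have hlim : Tendsto (fun n : ℕ => C * ((n : ℝ) ^ (-ρ) * Real.log n)) atTop (𝓝 0) := by
      have h1 : Tendsto (fun x : ℝ => Real.log x / x ^ ρ) atTop (𝓝 0) :=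
        (isLittleO_log_rpow_atTop hρ).tendsto_div_nhds_zero
      have h2 := (h1.comp tendsto_natCast_atTop_atTop).const_mul C
      rw [mul_zero] at h2
      refine h2.congr fun n => ?_
      rw [Function.comp_apply, Real.rpow_neg (Nat.cast_nonneg n), div_eq_mul_inv, mul_comm]
      ring
    -- The total is `5 * (ε / 10) + 4 * (ε / 10) < ε`; `u m` belongs to the family once `n ≥ m`.
    obtain ⟨m, hm⟩ := hdense p hp (ε / 10) (by positivity)
    have h1 := hprob p hp.1 (fun _ => ε / 10) (by
      filter_upwards [eventually_ge_atTop m] with n hn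
      exact ⟨Sum.inr ⟨m, by omega⟩, hm.le⟩)
    refine tendsto_of_tendsto_of_tendsto_of_le_of_le' tendsto_const_nhds h1
      (Eventually.of_forall fun _ => zero_le) ?_
    filter_upwards [hsel, hlim.eventually_le_const (show (0 : ℝ) < ε / 10 by positivity)]
      with n h2 h3
    exact errorProb_anti V p n (by linarith)
  · obtain ⟨-, -, -, -, hLmono⟩ := hWL
    set c : ℝ := 2 * (1 + 3 * d) with hc
    have h1 := hprob p hp.1.1 (fun n => c * (Real.log n + 1) * (K n : ℝ) ^ (-α)) (by
      filter_upwards [eventually_le_log_mul hγ hW, eventually_le_log_mul hγ hL] with n h2 h3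
      have hΛn : L ⌊(n : ℝ) ^ γ⌋₊ ≤ Λ n := by
        rw [hΛcoe]
        refine h3.trans ?_
        gcongr
        linarith
      obtain ⟨w, q, hw, hw1, hq, hqL, hτ⟩ := isNearMixture_of_mem_NLClass hLmono hp _ hΛn
      obtain ⟨s, hs⟩ := hcov n p hp.1 ⟨w, q, hw, hw1, hq, hqL, hτ.trans h2⟩
      refine ⟨Sum.inl s, hs.trans ?_⟩
      rw [hΛcoe]
      exact coverError_le hβ (hlog n) d (hK n))
    -- For `n ≥ 3`, `log n + 1 ≤ 2 * log n` turns the approximation factor `5 * c` into `10 * c`; `4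
    -- * C` is the stochastic part.
    refine ⟨10 * c + 4 * C, 1, ?_⟩
    refine tendsto_of_tendsto_of_tendsto_of_le_of_le' tendsto_const_nhds h1
      (Eventually.of_forall fun _ => zero_le) ?_
    filter_upwards [hsel, eventually_ge_atTop 3] with n h2 hn
    refine errorProb_anti V p n ?_
    have hn3 : (3 : ℝ) ≤ n := by exact_mod_cast hn
    have hn0 : (0 : ℝ) < n := by linarith
    have hlog1 : 1 ≤ Real.log n := by
      rw [Real.le_log_iff_exp_le hn0]
      exact (Real.exp_one_lt_d9.le.trans (by norm_num)).trans hn3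
    have hKρ : (K n : ℝ) ^ (-α) ≤ (n : ℝ) ^ (-ρ) := by
      calc (K n : ℝ) ^ (-α) ≤ ((n : ℝ) ^ γ) ^ (-α) :=
            Real.rpow_le_rpow_of_nonpos (by positivity) (rpow_le_succFloorRpow γ n) (by linarith)
        _ = (n : ℝ) ^ (-ρ) := by
            rw [← Real.rpow_mul hn0.le]; congr 1; rw [hγdef, hρdef]; ring
    have h3 : c * (Real.log n + 1) * (K n : ℝ) ^ (-α)
        ≤ c * (2 * Real.log n) * (n : ℝ) ^ (-ρ) := by
      gcongr
      linarith
    rw [pow_one]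
    calc _ ≤ 5 * (c * (2 * Real.log n) * (n : ℝ) ^ (-ρ))
          + 4 * (C * ((n : ℝ) ^ (-ρ) * Real.log n)) := by gcongr
      _ = _ := by ring
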